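/- Let $n\ge 1$ and let $\sigma\in\mathfrak S_n$ be a permutation. Draw $\sigma$ in a horizontal strip with $n$ points $1^-,\dots,n^-$ on the bottom boundary, $n$ points $1^+,\dots,n^+$ on the top boundary, and edges joining $i^-$ to $\sigma(i)^+$. Split each point $i^\pm$ into a black point $i_b^\pm$ and, to its right, a white point $i_w^\pm$. Replace each edge by the two edges $(i_b^-,\sigma(i)_w^+)$ and $(i_w^-,\sigma(i)_b^+)$, join $i_w^\pm$ to $(i+1)_b^\pm$ by an arc for $1\le i\le n-1$ (on the bottom and on the top), and join $n_w^+$ to $1_b^-$ by an arc. The result consists of one open path from $1_b^+$ to $n_w^-$, the rank path, and of $\ell\ge 0$ closed cycles. The length of a path or cycle is the number of top arcs $(i_w^+,(i+1)_b^+)$ that it contains. Let $r$ be the length of the rank path and let $\lambda$ be the multiset of the lengths of the $\ell$ cycles. For $I\subseteq[n]$ let $\chi(I)$ be the number of pairs $i<j$ in $I$ with $\sigma(i)<\sigma(j)$ (non-crossing edges), and put $$\overline A(\sigma)=\sum_{I\subseteq[n]}(-1)^{|I|+\chi(I)},\qquad s(\sigma)=\mathrm{Sign}(\overline A(\sigma))\in\{-1,0,1\}.$$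 Then: - the list $\lambda\cup\{r\}$ has an even number of even parts; - $\overline A(\sigma)=\pm 2^{\frac{n+\ell}{2}}$ if the list $\lambda\cup\{r\}$ has no even parts, and $\overline A(\sigma)=0$ otherwise; - consequently $s(\sigma)=2^{-\frac{n+\ell}{2}}\,\overline A(\sigma)$. -/

import Mathlib

/-- The two boundaries of the horizontal strip in which a permutation is drawn:
`i⁻` lies on the bottom boundary and `i⁺` on the top boundary. -/
inductive Side : Type
  | bot
  | top
  deriving DecidableEq

instance : Fintype Side :=
  ⟨{Side.bot, Side.top}, fun x => by cases x <;> simp⟩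

/-- Each endpoint `i^±` is split into a black endpoint and, to its right, a white one. -/
inductive Colour : Type
  | black
  | white
  deriving DecidableEq

instance : Fintype Colour :=
  ⟨{Colour.black, Colour.white}, fun x => by cases x <;> simp⟩

/-- The endpoints `i_b^-, i_w^-, i_b^+, i_w^+` with `i ∈ Fin n` (positions are numbered from `0`). -/
abbrev Endpoint (n : ℕ) : Type := Fin n × Side × Colour

namespace Rauzy

open Side Colour

/-- `Link σ x y`: the edges and arcs of the doubled diagram of `σ`. -/
inductive Link {n : ℕ} (σ : Equiv.Perm (Fin n)) : Endpoint n → Endpoint n → Prop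
  /-- the edge `(i_b^-, σ(i)_w^+)` -/
  | edgeBlack (i : Fin n) : Link σ (i, bot, black) (σ i, top, white)
  /-- the edge `(i_w^-, σ(i)_b^+)` -/
  | edgeWhite (i : Fin n) : Link σ (i, bot, white) (σ i, top, black)
  /-- the arc joining `i_w^±` and `(i+1)_b^±`, at the bottom and at the top -/
  | arc (s : Side) (i j : Fin n) (h : i.val + 1 = j.val) : Link σ (i, s, white) (j, s, black)
  /-- the `-1` mark: the arc joining the last white endpoint of the top boundary and the first
  black endpoint of the bottom boundary -/
  | mark (i j : Fin n) (hi : i.val + 1 = n) (hj : j.val = 0) :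
      Link σ (i, top, white) (j, bot, black)

/-- The doubled diagram of `σ` as a graph on the endpoints. Only its connected components are used
(for `n = 1` an edge and the `-1` mark join the same two endpoints, which form one component). -/
def diagram {n : ℕ} (σ : Equiv.Perm (Fin n)) : SimpleGraph (Endpoint n) :=
  SimpleGraph.fromRel (Link σ)

/-- The closed cycles and the open path of the doubled diagram: its connected components. -/
abbrev Strand {n : ℕ} (σ : Equiv.Perm (Fin n)) : Type :=
  (diagram σ).ConnectedComponent

/-- The rank path: the strand that contains the top-left endpoint. -/
def rankPath {n : ℕ} [NeZero n] (σ : Equiv.Perm (Fin n)) : Strand σ :=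
  (diagram σ).connectedComponentMk ((0 : Fin n), top, black)

open Classical in
/-- The length of a strand: the number of its top arcs. The top arcs start at the endpoints
`i_w^+` where `i` is not the last position. -/
noncomputable def length {n : ℕ} (σ : Equiv.Perm (Fin n)) (C : Strand σ) : ℕ :=
  (Finset.univ.filter fun i : Fin n =>
    i.val + 1 < n ∧ (diagram σ).connectedComponentMk (i, top, white) = C).card

/-- The rank `r` of `σ`: the length of the rank path. -/
noncomputable def rank {n : ℕ} [NeZero n] (σ : Equiv.Perm (Fin n)) : ℕ :=
  length σ (rankPath σ)

open Classical in
/-- The cycles of `σ`: the strands other than the rank path. -/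
noncomputable def cycles {n : ℕ} [NeZero n] (σ : Equiv.Perm (Fin n)) : Finset (Strand σ) :=
  Finset.univ.erase (rankPath σ)

/-- The cycle structure `λ` of `σ`: the multiset of the lengths of its cycles. -/
noncomputable def cycleStructure {n : ℕ} [NeZero n] (σ : Equiv.Perm (Fin n)) : Multiset ℕ :=
  (cycles σ).val.map (length σ)

/-- The number `ℓ` of cycles of `σ`, not including the rank path. -/
noncomputable def numCycles {n : ℕ} [NeZero n] (σ : Equiv.Perm (Fin n)) : ℕ :=
  (cycles σ).card

/-- `χ(I)`: the number of pairs of non-crossing edges in the set `I` of edges of `σ`, an edge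
being labelled by its bottom endpoint. -/
def chi {n : ℕ} (σ : Equiv.Perm (Fin n)) (I : Finset (Fin n)) : ℕ :=
  ((I ×ˢ I).filter fun p => p.1 < p.2 ∧ σ p.1 < σ p.2).card

/-- The Arf invariant `Ā(σ) = ∑_{I ⊆ [n]} (-1)^(|I| + χ(I))`. -/
def arf {n : ℕ} (σ : Equiv.Perm (Fin n)) : ℤ :=
  ∑ I : Finset (Fin n), (-1 : ℤ) ^ (I.card + chi σ I)

/-- The sign `s(σ) ∈ {-1, 0, 1}` of `σ`: the sign of its Arf invariant. -/
def sgn {n : ℕ} (σ : Equiv.Perm (Fin n)) : ℤ :=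
  Int.sign (arf σ)

end Rauzy

namespace Rauzy

open Equiv Side Colour

/-! The Arf invariant is a Gauss sum `∑ (-1)^q(x)` over `F₂^n`, with `q` a quadratic form. Its
square is `2^n` times the sum of `(-1)^q` over the radical of the polarization (`gaussSum_sq`).

The radical is read off the diagram. Label the strands by elements of `F₂` and give each edge of `σ`
the sum of the labels of its two halves. This maps labellings onto the radical, two to one,
constants being the kernel (`sum_labelVec`). On the radical `q` is additive, so it pulls back to a
linear form on labellings. A character sum of a linear form is the size of the space or zero, so
everything depends on the values at single strands.

The value at a strand `C` is `length C + 1` mod 2 (`strandForm_single`). The crossings among the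
halves in `C` are inversions of a permutation that has `C` as a single cycle, and the sign of a
cycle depends only on its length.

Hence an even part forces the sum to vanish; otherwise `2 Ā² = 2^n 2^(ℓ+1)`. The all-ones labelling
maps to zero, so the values at all strands sum to zero: the number of even parts is even. -/

/-! ### Inversions and cycles of permutations -/

theorem natCast_zmod_two_eq_of_neg_one_pow_eq {a b : ℕ} (h : (-1 : ℤ) ^ a = (-1) ^ b) :
    (a : ZMod 2) = b := by
  rcases Nat.even_or_odd a with ha | ha <;> rcases Nat.even_or_odd b with hb | hb
  · rw [(ZMod.natCast_eq_zero_iff_even).2 ha, (ZMod.natCast_eq_zero_iff_even).2 hb]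
  · rw [ha.neg_one_pow, hb.neg_one_pow] at h; norm_num at h
  · rw [ha.neg_one_pow, hb.neg_one_pow] at h; norm_num at h
  · rw [(ZMod.natCast_eq_one_iff_odd).2 ha, (ZMod.natCast_eq_one_iff_odd).2 hb]

/-- The sign of a permutation counts its inversions with respect to any injective ranking. -/
theorem sign_eq_neg_one_pow_inversions {α : Type*} [Fintype α] [DecidableEq α] (r : α → ℕ)
    (hr : Function.Injective r) (π : Perm α) :
    ((Perm.sign π : ℤˣ) : ℤ) =
      (-1) ^ (∑ a, ∑ b, if r a < r b ∧ r (π b) < r (π a) then 1 else 0) := by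
  let _ : LinearOrder α := LinearOrder.lift' r hr
  have hlt : ∀ a b : α, a < b ↔ r a < r b := fun a b => Iff.rfl
  let e : Fin (Fintype.card α) ≃o α := Fintype.orderIsoFinOfCardEq α rfl
  have h1 : Perm.sign (e.symm.toEquiv.permCongr π) = Perm.sign π := Perm.sign_permCongr _ _
  rw [← h1, Perm.sign_eq_prod_prod_Ioi, ← Finset.prod_pow_eq_pow_sum,
    ← e.toEquiv.prod_comp, Units.coe_prod]
  refine Finset.prod_congr rfl fun i _ => ?_
  rw [← Finset.prod_pow_eq_pow_sum, ← e.toEquiv.prod_comp, Units.coe_prod,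
    ← Finset.prod_subset (Finset.subset_univ (Finset.Ioi i))]
  · refine Finset.prod_congr rfl fun j hj => ?_
    have hij : i < j := Finset.mem_Ioi.1 hj
    have h2 : r (e i) < r (e j) := (hlt _ _).1 (e.lt_iff_lt.2 hij)
    have h3 : (e.symm (π (e i)) < e.symm (π (e j))) ↔ ¬ r (π (e j)) < r (π (e i)) := by
      rw [e.symm.lt_iff_lt, hlt, not_lt]
      refine ⟨le_of_lt, fun h => lt_of_le_of_ne h fun h' => ?_⟩
      exact hij.ne (e.injective (π.injective (hr h')))
    have h4 : (e.symm.toEquiv.permCongr π i < e.symm.toEquiv.permCongr π j) ↔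
        ¬ r (π (e j)) < r (π (e i)) := h3
    simp only [h4, RelIso.coe_fn_toEquiv]
    by_cases h5 : r (π (e j)) < r (π (e i)) <;> simp [h2, h5]
  · intro j _ hj
    have hij : ¬ i < j := fun h => hj (Finset.mem_Ioi.2 h)
    have h2 : ¬ r (e i) < r (e j) := fun h => hij (e.lt_iff_lt.1 ((hlt _ _).2 h))
    simp [h2]

theorem sign_of_forall_sameCycle {α : Type*} [Fintype α] [DecidableEq α] [Nonempty α]
    (π : Perm α) (h : ∀ x y, π.SameCycle x y) :
    ((Perm.sign π : ℤˣ) : ℤ) = (-1) ^ (Fintype.card α + 1) := by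
  -- A one-point type is treated apart, because the identity is not an `IsCycle`.
  rcases subsingleton_or_nontrivial α with hs | hs
  · have h1 : π = 1 := Subsingleton.elim _ _
    have h2 : Fintype.card α = 1 := Fintype.card_eq_one_iff_nonempty_unique.2
      ⟨⟨⟨Classical.arbitrary α⟩, fun _ => Subsingleton.elim _ _⟩⟩
    simp [h1, h2]
  · have hon : π.IsCycleOn (Set.univ : Set α) :=
      ⟨Set.bijOn_univ.2 π.bijective, fun x _ y _ => h x y⟩
    have hne : ∀ x, π x ≠ x := fun x => hon.apply_ne Set.nontrivial_univ (Set.mem_univ x)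
    have hc : π.IsCycle :=
      ⟨Classical.arbitrary α, hne _, fun y _ => h _ y⟩
    have hsupp : π.support = Finset.univ := by ext x; simp [hne x]
    rw [hc.sign, hsupp, Finset.card_univ, pow_succ]
    simp

/-- On a single cycle of `π`, the number of inversions has the parity of the length plus one. -/
theorem sum_inversions_of_cycle {α : Type*} [Fintype α] [DecidableEq α] (r : α → ℕ)
    (hr : Function.Injective r) (π : Perm α) (p : α → Prop) [DecidablePred p]
    (hp : ∀ x, p (π x) ↔ p x) (hne : ∃ x, p x)
    (hc : ∀ x y, p x → p y → π.SameCycle x y) :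
    (∑ a, ∑ b, if r a < r b ∧ r (π b) < r (π a) then
        (if p a then 1 else 0) * (if p b then 1 else 0) else (0 : ZMod 2)) =
      (∑ a, if p a then 1 else 0) + 1 := by
  have : Nonempty {x // p x} := ⟨⟨hne.choose, hne.choose_spec⟩⟩
  have h1 := sign_of_forall_sameCycle (π.subtypePerm hp) fun x y =>
    Perm.sameCycle_subtypePerm.2 (hc x y x.2 y.2)
  rw [sign_eq_neg_one_pow_inversions (fun x : {x // p x} => r x)
    (fun x y h => Subtype.ext (hr h))] at h1
  have h2 := natCast_zmod_two_eq_of_neg_one_pow_eq h1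
  have h3 : ∀ F : α → ZMod 2, (∑ a : {x // p x}, F a) = ∑ a, if p a then F a else 0 := by
    intro F
    rw [← Finset.sum_filter]
    exact (Finset.sum_subtype (Finset.univ.filter p) (by simp) F).symm
  push_cast at h2
  have h4 : ((Fintype.card {x // p x} : ℕ) : ZMod 2) = ∑ a, if p a then 1 else 0 := by
    rw [Fintype.card_subtype]; simp
  have h5 : (∑ a : {x // p x}, ∑ b : {x // p x},
      if r a < r b ∧ r (π b) < r (π a) then (1 : ZMod 2) else 0) =
      (∑ a, if p a then 1 else 0) + 1 := by
    rw [← h4]; exact h2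
  rw [← h5, h3 (fun a => ∑ b : {x // p x}, if r a < r b ∧ r (π b) < r (π a) then 1 else 0)]
  refine Finset.sum_congr rfl fun a _ => ?_
  rw [h3 (fun b => if r a < r b ∧ r (π b) < r (π a) then 1 else 0)]
  by_cases ha : p a
  · simp only [ha, if_true, one_mul]
    refine Finset.sum_congr rfl fun b _ => ?_
    by_cases hb : p b <;> simp [hb]
  · simp [ha]

/-- If every step `x ↦ π x` but one stays inside a class, so does the remaining one. -/
theorem rel_apply_of_rel_apply_of_ne {α : Type*} [Finite α] (π : Perm α) {R : α → α → Prop}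
    (hR : Equivalence R) (e : α) (h : ∀ x, x ≠ e → R x (π x)) (x : α) : R x (π x) := by
  by_cases hx : x = e
  · subst hx
    by_contra hcon
    -- If `x` is outside the class of `π x`, then `π` maps this class into itself, hence onto itself
    -- by finiteness. The preimage of `π x` then lies in the class, but it is `x`.
    have hmaps : Set.MapsTo π {y | R (π x) y} {y | R (π x) y} := fun y hy => by
      refine hR.trans hy (h y ?_)
      rintro rfl
      exact hcon (hR.symm hy)
    obtain ⟨y, hy, hyx⟩ := ((Set.toFinite {y | R (π x) y}).injOn_iff_bijOn_of_mapsTo hmaps).1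
      π.injective.injOn |>.surjOn (hR.refl (π x))
    rw [π.injective hyx] at hy
    exact hcon (hR.symm hy)
  · exact h x hx

/-! ### Characters and quadratic Gauss sums over `ZMod 2` -/

/-- The nontrivial character `ZMod 2 → {1, -1}`. -/
def signChar (a : ZMod 2) : ℤ := if a = 0 then 1 else -1

theorem signChar_add (a b : ZMod 2) : signChar (a + b) = signChar a * signChar b := by
  revert a b; decide

theorem signChar_natCast (k : ℕ) : signChar (k : ZMod 2) = (-1) ^ k := by
  rcases Nat.even_or_odd k with h | h
  · rw [(ZMod.natCast_eq_zero_iff_even).2 h, h.neg_one_pow]; rfl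
  · rw [(ZMod.natCast_eq_one_iff_odd).2 h, h.neg_one_pow]; rfl

theorem zmod_two_eq_one_of_ne_zero {a : ZMod 2} (h : a ≠ 0) : a = 1 := by
  revert a; decide

theorem sum_signChar_of_eq_zero {V : Type*} [AddCommGroup V] [Fintype V] (h : V →+ ZMod 2)
    (h0 : ∀ x, h x = 0) : ∑ x, signChar (h x) = Fintype.card V := by
  simp [h0, signChar]

/-- Translation by `x₀` negates every term. -/
theorem sum_signChar_of_ne_zero {V : Type*} [AddCommGroup V] [Fintype V] (h : V →+ ZMod 2)
    {x₀ : V} (h0 : h x₀ ≠ 0) : ∑ x, signChar (h x) = 0 := by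
  have h1 : ∑ x, signChar (h (x + x₀)) = ∑ x, signChar (h x) :=
    Equiv.sum_comp (Equiv.addRight x₀) fun x => signChar (h x)
  have h2 : ∀ x, signChar (h (x + x₀)) = - signChar (h x) := fun x => by
    rw [map_add, zmod_two_eq_one_of_ne_zero h0, signChar_add]
    simp [signChar]
  simp only [h2, Finset.sum_neg_distrib] at h1
  linarith

section QuadraticForm

variable {ι : Type*} [Fintype ι]

/-- The quadratic form `∑ i, x i + ∑ i j, m i j * x i * x j`. -/
def quadForm (m : ι → ι → ZMod 2) (x : ι → ZMod 2) : ZMod 2 :=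
  ∑ i, x i + ∑ i, ∑ j, m i j * x i * x j

/-- The linear form attached to `y` by the polarization of `quadForm m`, as a vector. -/
def polarVec (m : ι → ι → ZMod 2) (y : ι → ZMod 2) (j : ι) : ZMod 2 :=
  ∑ i, (m i j + m j i) * y i

theorem quadForm_add (m : ι → ι → ZMod 2) (x y : ι → ZMod 2) :
    quadForm m (x + y) = quadForm m x + quadForm m y + ∑ j, polarVec m y j * x j := by
  have h : ∑ j, polarVec m y j * x j =
      ∑ i, ∑ j, m i j * y i * x j + ∑ i, ∑ j, m i j * x i * y j := by
    simp only [polarVec, add_mul, Finset.sum_add_distrib, Finset.sum_mul]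
    congr 1
    · rw [Finset.sum_comm]
    · exact Finset.sum_congr rfl fun i _ => Finset.sum_congr rfl fun j _ => by ring
  rw [h]
  simp only [quadForm, Pi.add_apply, mul_add, add_mul, Finset.sum_add_distrib]
  ring

theorem quadForm_add_of_polarVec_eq_zero (m : ι → ι → ZMod 2) (x : ι → ZMod 2)
    {y : ι → ZMod 2} (hy : polarVec m y = 0) :
    quadForm m (x + y) = quadForm m x + quadForm m y := by
  rw [quadForm_add, hy]; simp

/-- The square of a quadratic Gauss sum is a sum over the radical. -/
theorem gaussSum_sq [DecidableEq ι] (m : ι → ι → ZMod 2) :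
    (∑ x, signChar (quadForm m x)) ^ 2 =
      2 ^ Fintype.card ι *
        ∑ y, if polarVec m y = 0 then signChar (quadForm m y) else 0 := by
  -- Substitute `x + y` for `y`; the two factors in `quadForm m x` cancel and the polarization
  -- remains.
  have h1 : ∀ x, ∑ y, signChar (quadForm m x) * signChar (quadForm m y) =
      ∑ y, signChar (quadForm m y) * signChar (∑ j, polarVec m y j * x j) := by
    intro x
    rw [← Equiv.sum_comp (Equiv.addLeft x)]
    refine Finset.sum_congr rfl fun y _ => ?_
    rw [Equiv.coe_addLeft, quadForm_add, signChar_add, signChar_add]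
    have : signChar (quadForm m x) * signChar (quadForm m x) = 1 := by
      unfold signChar; split_ifs <;> norm_num
    linear_combination
      (signChar (quadForm m y) * signChar (∑ j, polarVec m y j * x j)) * this
  have h2 : ∀ y, ∑ x : ι → ZMod 2, signChar (∑ j, polarVec m y j * x j) =
      if polarVec m y = 0 then 2 ^ Fintype.card ι else 0 := by
    intro y
    let h : (ι → ZMod 2) →+ ZMod 2 :=
      { toFun := fun x => ∑ j, polarVec m y j * x j
        map_zero' := by simp
        map_add' := fun a b => by simp [mul_add, Finset.sum_add_distrib] }
    split_ifs with hy
    · have := sum_signChar_of_eq_zero h fun x => by simp [h, hy]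
      simpa [h] using this
    · obtain ⟨j, hj⟩ := Function.ne_iff.1 hy
      exact sum_signChar_of_ne_zero h (x₀ := Pi.single j 1) (by simpa [h, Pi.single_apply] using hj)
  rw [sq, Finset.sum_mul_sum, Finset.sum_congr rfl fun x _ => h1 x, Finset.sum_comm,
    Finset.mul_sum]
  refine Finset.sum_congr rfl fun y _ => ?_
  rw [← Finset.mul_sum, h2]
  split_ifs <;> ring

end QuadraticForm

/-! ### The Arf invariant as a Gauss sum -/

/-- The matrix of the pairs of non-crossing edges. -/
def noncross {n : ℕ} (σ : Equiv.Perm (Fin n)) (i j : Fin n) : ZMod 2 :=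
  if i < j ∧ σ i < σ j then 1 else 0

/-- The indicator function of a finite set, as an equivalence. -/
def indicatorEquiv (ι : Type*) [Fintype ι] [DecidableEq ι] : Finset ι ≃ (ι → ZMod 2) where
  toFun I i := if i ∈ I then 1 else 0
  invFun x := Finset.univ.filter fun i => x i = 1
  left_inv I := by ext i; simp
  right_inv x := by
    funext i
    by_cases h : x i = 0
    · simp [h]
    · simp [zmod_two_eq_one_of_ne_zero h]

theorem arf_eq_gaussSum {n : ℕ} (σ : Equiv.Perm (Fin n)) :
    arf σ = ∑ x, signChar (quadForm (noncross σ) x) := by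
  rw [arf, ← (indicatorEquiv (Fin n)).sum_comp]
  refine Finset.sum_congr rfl fun I _ => ?_
  rw [← signChar_natCast]
  congr 1
  rw [Nat.cast_add, quadForm]
  congr 1
  · simp [indicatorEquiv]
  · rw [chi, Finset.card_filter, Finset.sum_product]
    push_cast
    simp only [indicatorEquiv, Equiv.coe_fn_mk, noncross]
    rw [← Finset.sum_subset (Finset.subset_univ I)]
    · refine Finset.sum_congr rfl fun i hi => ?_
      rw [← Finset.sum_subset (Finset.subset_univ I)]
      · exact Finset.sum_congr rfl fun j hj => by simp [hi, hj]
      · intro j _ hj; simp [hj]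
    · intro i _ hi; simp [hi]

/-! ### Labellings of the strands -/

/-- The strand through an endpoint. -/
abbrev strand {n : ℕ} (σ : Equiv.Perm (Fin n)) (e : Endpoint n) : Strand σ :=
  (diagram σ).connectedComponentMk e

section Strand

variable {n : ℕ} {σ : Equiv.Perm (Fin n)}

theorem strand_eq_of_link {x y : Endpoint n} (h : Link σ x y) : strand σ x = strand σ y := by
  by_cases hxy : x = y
  · rw [hxy]
  · exact SimpleGraph.ConnectedComponent.sound
      (SimpleGraph.Adj.reachable ((SimpleGraph.fromRel_adj _ _ _).2 ⟨hxy, Or.inl h⟩))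

theorem eq_of_strand_eq {R : Type*} {G : Endpoint n → R}
    (hG : ∀ x y, Link σ x y → G x = G y) {x y : Endpoint n} (h : strand σ x = strand σ y) :
    G x = G y := by
  obtain ⟨p⟩ := SimpleGraph.ConnectedComponent.exact h
  induction p with
  | nil => rfl
  | cons hadj _ ih =>
    refine Eq.trans ?_ (ih (SimpleGraph.ConnectedComponent.sound ⟨by assumption⟩))
    rcases ((SimpleGraph.fromRel_adj _ _ _).1 hadj).2 with h1 | h1
    · exact hG _ _ h1
    · exact (hG _ _ h1).symm

theorem exists_strand_lift {R : Type*} {G : Endpoint n → R}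
    (hG : ∀ x y, Link σ x y → G x = G y) : ∃ g : Strand σ → R, ∀ e, g (strand σ e) = G e :=
  ⟨fun C => G C.out, fun e => eq_of_strand_eq hG (Quot.out_eq (strand σ e))⟩

end Strand

/-! ### Telescoping along a boundary -/

section Telescope

variable {m : ℕ} {u w : Fin (m + 1) → ZMod 2}

/-- Here `u` and `w` stand for the labels of the black and white endpoints of one boundary, and `h`
for the arcs; interior labels occur twice and cancel in characteristic 2. -/
theorem sum_lt_telescope (h : ∀ i : Fin m, w i.castSucc = u i.succ) (j : Fin (m + 1)) :
    ∑ i, (if i < j then w i + u i else 0) = u 0 + u j := by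
  induction j using Fin.induction with
  | zero => simp [CharTwo.add_self_eq_zero]
  | succ j ih =>
    have h1 : ∀ i, (if i < j.succ then w i + u i else 0) =
        (if i < j.castSucc then w i + u i else 0) +
          if i = j.castSucc then w i + u i else 0 := by
      intro i
      have h2 : i < j.succ ↔ i < j.castSucc ∨ i = j.castSucc := by
        rw [← le_iff_lt_or_eq, Fin.le_castSucc_iff]
      by_cases h3 : i = j.castSucc
      · simp [h3]
      · simp [h2, h3]
    rw [Finset.sum_congr rfl fun i _ => h1 i, Finset.sum_add_distrib, ih]
    simp only [Finset.sum_ite_eq', Finset.mem_univ, if_true, h j]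
    linear_combination CharTwo.add_self_eq_zero (u j.castSucc)

theorem sum_gt_telescope (h : ∀ i : Fin m, w i.castSucc = u i.succ) (j : Fin (m + 1)) :
    ∑ i, (if j < i then w i + u i else 0) = w j + w (Fin.last m) := by
  induction j using Fin.reverseInduction with
  | last =>
    have h1 : ∀ i : Fin (m + 1), ¬ Fin.last m < i := fun i => not_lt.2 (Fin.le_last i)
    simp [h1, CharTwo.add_self_eq_zero]
  | cast j ih =>
    have h1 : ∀ i, (if j.castSucc < i then w i + u i else 0) =
        (if j.succ < i then w i + u i else 0) + if i = j.succ then w i + u i else 0 := by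
      intro i
      have h2 : j.castSucc < i ↔ j.succ < i ∨ i = j.succ := by
        rw [Fin.castSucc_lt_iff_succ_le, le_iff_lt_or_eq, eq_comm]
      by_cases h3 : i = j.succ
      · simp [h3]
      · simp [h2, h3]
    rw [Finset.sum_congr rfl fun i _ => h1 i, Finset.sum_add_distrib, ih]
    simp only [Finset.sum_ite_eq', Finset.mem_univ, if_true, h j]
    linear_combination CharTwo.add_self_eq_zero (w j.succ)

end Telescope

/-- An edge `i` that crosses `j` satisfies both conditions or neither, so it drops out mod 2; a
non-crossing one satisfies exactly one. The separated conditions can each be telescoped. -/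
theorem polarVec_noncross {n : ℕ} (σ : Equiv.Perm (Fin n)) (x : Fin n → ZMod 2) (j : Fin n) :
    polarVec (noncross σ) x j =
      ∑ i, (if i < j then x i else 0) + ∑ i, if σ j < σ i then x i else 0 := by
  rw [polarVec, ← Finset.sum_add_distrib]
  refine Finset.sum_congr rfl fun i _ => ?_
  unfold noncross
  rcases lt_trichotomy i j with h | h | h
  · have h' : ¬ j < i := h.asymm
    rcases lt_trichotomy (σ i) (σ j) with hs | hs | hs
    · simp [h, h', hs, hs.asymm]
    · exact absurd (σ.injective hs) h.ne
    · simp [h, h', hs, hs.asymm, CharTwo.add_self_eq_zero]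
  · simp [h]
  · have h' : ¬ i < j := h.asymm
    rcases lt_trichotomy (σ i) (σ j) with hs | hs | hs
    · simp [h, h', hs, hs.asymm]
    · exact absurd (σ.injective hs) h.ne'
    · simp [h, h', hs, hs.asymm]

/-- The vector attached to a labelling of the strands: the sum of the labels of the two edges
into which an edge of `σ` is split. -/
def labelVec {n : ℕ} (σ : Equiv.Perm (Fin n)) : (Strand σ → ZMod 2) →+ (Fin n → ZMod 2) where
  toFun g i := g (strand σ (i, bot, white)) + g (strand σ (i, bot, black))
  map_zero' := by funext i; simp
  map_add' g h := by funext i; simp only [Pi.add_apply]; ring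

/-! ### The radical as the image of the strand labellings -/

section Radical

variable {m : ℕ} {σ : Equiv.Perm (Fin (m + 1))}

theorem strand_arc (s : Side) (i : Fin m) :
    strand σ (i.castSucc, s, white) = strand σ (i.succ, s, black) :=
  strand_eq_of_link (Link.arc s _ _ (by simp))

theorem strand_mark : strand σ (Fin.last m, top, white) = strand σ (0, bot, black) :=
  strand_eq_of_link (Link.mark _ _ (by simp) (by simp))

theorem strand_edgeBlack (i : Fin (m + 1)) :
    strand σ (i, bot, black) = strand σ (σ i, top, white) :=
  strand_eq_of_link (Link.edgeBlack i)

theorem strand_edgeWhite (i : Fin (m + 1)) :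
    strand σ (i, bot, white) = strand σ (σ i, top, black) :=
  strand_eq_of_link (Link.edgeWhite i)

/-- The bottom sum left of `j` and the top sum right of `σ j` both telescope to the label of `j_b^-`
plus the label of the mark: the edge at `j` and the mark identify the end terms. -/
theorem polarVec_labelVec (g : Strand σ → ZMod 2) :
    polarVec (noncross σ) (labelVec σ g) = 0 := by
  funext j
  rw [polarVec_noncross]
  have h1 := sum_lt_telescope (u := fun i => g (strand σ (i, bot, black)))
    (w := fun i => g (strand σ (i, bot, white))) (fun i => by rw [strand_arc]) j
  have h2 := sum_gt_telescope (u := fun i => g (strand σ (i, top, black)))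
    (w := fun i => g (strand σ (i, top, white))) (fun i => by rw [strand_arc]) (σ j)
  rw [← Equiv.sum_comp σ] at h2
  simp only [← strand_edgeBlack, ← strand_edgeWhite, strand_mark] at h1 h2
  have h3 : ∀ i, labelVec σ g i = g (strand σ (i, bot, white)) + g (strand σ (i, bot, black)) :=
    fun _ => rfl
  have h4 : ∀ i, labelVec σ g i = g (strand σ (i, bot, black)) + g (strand σ (i, bot, white)) :=
    fun _ => add_comm _ _
  rw [Finset.sum_congr rfl fun i _ => by rw [h3 i], h1,
    Finset.sum_congr rfl fun i _ => by rw [h4 i], h2]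
  rw [Pi.zero_apply]
  linear_combination CharTwo.add_self_eq_zero (g (strand σ (j, bot, black))) +
    CharTwo.add_self_eq_zero (g (strand σ (0, bot, black)))

/-- Starting from the mark, the vector determines the labels one by one along the bottom boundary,
and every top endpoint is joined to a bottom one. -/
theorem labelVec_injective_of_mark {g h : Strand σ → ZMod 2} (hv : labelVec σ g = labelVec σ h)
    (hm : g (strand σ (0, bot, black)) = h (strand σ (0, bot, black))) : g = h := by
  have hx : ∀ i, g (strand σ (i, bot, white)) + g (strand σ (i, bot, black)) =
      h (strand σ (i, bot, white)) + h (strand σ (i, bot, black)) := fun i => congrFun hv i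
  have hb : ∀ j, g (strand σ (j, bot, black)) = h (strand σ (j, bot, black)) := by
    intro j
    have h1 := sum_lt_telescope (u := fun i => g (strand σ (i, bot, black)))
      (w := fun i => g (strand σ (i, bot, white))) (fun i => by rw [strand_arc]) j
    have h2 := sum_lt_telescope (u := fun i => h (strand σ (i, bot, black)))
      (w := fun i => h (strand σ (i, bot, white))) (fun i => by rw [strand_arc]) j
    simp only [hx] at h1
    rw [h1, hm] at h2
    exact add_left_cancel h2
  have hw : ∀ j, g (strand σ (j, bot, white)) = h (strand σ (j, bot, white)) := fun j => by
    have := hx j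
    rw [hb] at this
    exact add_right_cancel this
  funext C
  induction C using SimpleGraph.ConnectedComponent.ind with
  | h e =>
    obtain ⟨k, s, c⟩ := e
    obtain ⟨i, rfl⟩ := σ.surjective k
    cases s <;> cases c
    · exact hb _
    · exact hw _
    · have := hw i
      rw [strand_edgeWhite] at this
      exact this
    · have := hb i
      rw [strand_edgeBlack] at this
      exact this

/-- The label, at each endpoint, of the labelling attached to a vector of the radical. -/
def endpointLabel (σ : Equiv.Perm (Fin (m + 1))) (y : Fin (m + 1) → ZMod 2) :
    Endpoint (m + 1) → ZMod 2
  | (i, bot, black) => ∑ j, if j < i then y j else 0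
  | (i, bot, white) => ∑ j, if j ≤ i then y j else 0
  | (k, top, black) => ∑ j, if k ≤ σ j then y j else 0
  | (k, top, white) => ∑ j, if k < σ j then y j else 0

theorem sum_le_eq_add (y : Fin (m + 1) → ZMod 2) (i : Fin (m + 1)) :
    (∑ j, if j ≤ i then y j else 0) = (∑ j, if j < i then y j else 0) + y i := by
  have h : ∀ j, (if j ≤ i then y j else 0) =
      (if j < i then y j else 0) + if j = i then y j else 0 := by
    intro j
    by_cases h : j = i
    · simp [h]
    · simp [h, le_iff_lt_or_eq]
  rw [Finset.sum_congr rfl fun j _ => h j, Finset.sum_add_distrib]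
  simp

theorem sum_image_le_eq_add (y : Fin (m + 1) → ZMod 2) (i : Fin (m + 1)) :
    (∑ j, if σ i ≤ σ j then y j else 0) = (∑ j, if σ i < σ j then y j else 0) + y i := by
  have h : ∀ j, (if σ i ≤ σ j then y j else 0) =
      (if σ i < σ j then y j else 0) + if j = i then y j else 0 := by
    intro j
    by_cases h : j = i
    · simp [h]
    · have h' : ¬ i = j := fun h' => h h'.symm
      simp [h, h', le_iff_lt_or_eq]
  rw [Finset.sum_congr rfl fun j _ => h j, Finset.sum_add_distrib]
  simp

/-- The radical equation at `i` is exactly compatibility along the black edge; the white edge adds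
`y i` to both sides. Arcs only rewrite the summation range, and at the mark both sums are empty. -/
theorem endpointLabel_eq_of_link {y : Fin (m + 1) → ZMod 2}
    (hy : polarVec (noncross σ) y = 0) {a b : Endpoint (m + 1)} (h : Link σ a b) :
    endpointLabel σ y a = endpointLabel σ y b := by
  have hrad : ∀ i, (∑ j, if j < i then y j else 0) = ∑ j, if σ i < σ j then y j else 0 := by
    intro i
    have := congrFun hy i
    rw [polarVec_noncross] at this
    exact CharTwo.add_eq_zero.1 this
  cases h with
  | edgeBlack i => exact hrad i
  | edgeWhite i =>
    change (∑ j, if j ≤ i then y j else 0) = ∑ j, if σ i ≤ σ j then y j else 0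
    rw [sum_le_eq_add, sum_image_le_eq_add, hrad]
  | arc s i j h =>
    cases s
    · refine Finset.sum_congr rfl fun k _ => ?_
      have : k ≤ i ↔ k < j := by rw [Fin.le_def, Fin.lt_def]; omega
      simp only [this]
    · refine Finset.sum_congr rfl fun k _ => ?_
      have : i < σ k ↔ j ≤ σ k := by rw [Fin.le_def, Fin.lt_def]; omega
      simp only [this]
  | mark i j hi hj =>
    have h1 : ∀ k, ¬ i < σ k := fun k => by rw [Fin.lt_def]; omega
    have h2 : ∀ k, ¬ k < j := fun k => by rw [Fin.lt_def]; omega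
    simp [endpointLabel, h1, h2]

theorem exists_labelVec_eq {y : Fin (m + 1) → ZMod 2} (hy : polarVec (noncross σ) y = 0)
    (c : ZMod 2) : ∃ g, labelVec σ g = y ∧ g (strand σ (0, bot, black)) = c := by
  obtain ⟨g, hg⟩ := exists_strand_lift (σ := σ) (G := fun e => c + endpointLabel σ y e)
    fun a b h => by rw [endpointLabel_eq_of_link hy h]
  refine ⟨g, ?_, ?_⟩
  · funext i
    change g _ + g _ = _
    rw [hg, hg]
    change c + (∑ j, if j ≤ i then y j else 0) + (c + ∑ j, if j < i then y j else 0) = y i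
    rw [sum_le_eq_add]
    linear_combination CharTwo.add_self_eq_zero c +
      CharTwo.add_self_eq_zero (∑ j, if j < i then y j else 0)
  · rw [hg]
    simp [endpointLabel]

/-- A labelling amounts to a radical vector together with a free label at the mark, whence the
factor 2. -/
theorem sum_labelVec [Fintype (Strand σ)] [DecidableEq (Strand σ)]
    (H : (Fin (m + 1) → ZMod 2) → ℤ) :
    ∑ g, H (labelVec σ g) = 2 * ∑ y, if polarVec (noncross σ) y = 0 then H y else 0 := by
  rw [← Finset.sum_filter]
  have h : ∑ g, H (labelVec σ g) = ∑ p ∈ (Finset.univ.filter fun y =>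
      polarVec (noncross σ) y = 0) ×ˢ (Finset.univ : Finset (ZMod 2)), H p.1 := by
    refine Finset.sum_nbij (fun g => (labelVec σ g, g (strand σ (0, bot, black)))) ?_ ?_ ?_ ?_
    · intro g _
      simp [polarVec_labelVec]
    · intro g _ h _ hgh
      exact labelVec_injective_of_mark (Prod.ext_iff.1 hgh).1 (Prod.ext_iff.1 hgh).2
    · rintro ⟨y, c⟩ hy
      have hy' : polarVec (noncross σ) y = 0 := by simpa using hy
      obtain ⟨g, h1, h2⟩ := exists_labelVec_eq hy' c
      exact ⟨g, by simp, Prod.ext h1 h2⟩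
    · intro g _; rfl
  rw [h, Finset.sum_product]
  simp [Finset.mul_sum, ZMod.card]

/-- The Arf quadratic form as a linear form on the labellings of the strands. -/
def strandForm (σ : Equiv.Perm (Fin (m + 1))) : (Strand σ → ZMod 2) →+ ZMod 2 where
  toFun g := quadForm (noncross σ) (labelVec σ g)
  map_zero' := by simp [quadForm]
  map_add' g h := by rw [map_add, quadForm_add_of_polarVec_eq_zero _ _ (polarVec_labelVec h)]

theorem two_mul_arf_sq [Fintype (Strand σ)] [DecidableEq (Strand σ)] :
    2 * arf σ ^ 2 = 2 ^ (m + 1) * ∑ g, signChar (strandForm σ g) := by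
  rw [arf_eq_gaussSum, gaussSum_sq]
  have := sum_labelVec (σ := σ) fun y => signChar (quadForm (noncross σ) y)
  change _ = _ * ∑ g, signChar (quadForm (noncross σ) (labelVec σ g))
  rw [this, Fintype.card_fin]
  ring

theorem strandForm_one [Fintype (Strand σ)] [DecidableEq (Strand σ)] :
    ∑ C, strandForm σ (Pi.single C 1) = 0 := by
  rw [← map_sum, Finset.univ_sum_single]
  have : labelVec σ (fun _ => 1) = 0 := by
    funext i; exact CharTwo.add_self_eq_zero (1 : ZMod 2)
  change quadForm (noncross σ) (labelVec σ fun _ => 1) = 0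
  rw [this]
  simp [quadForm]

end Radical

/-! ### The strands as cycles of a permutation of the black endpoints -/

section Flow

variable {m : ℕ}

/-- The position of a black endpoint when the bottom boundary is followed by the top boundary. -/
def position : Fin (m + 1) × Side → ℕ
  | (i, bot) => i
  | (i, top) => m + 1 + i

theorem position_injective : Function.Injective (position (m := m)) := by
  rintro ⟨i, s⟩ ⟨j, t⟩ h
  cases s <;> cases t <;> simp only [position] at h
  · rw [Fin.ext h]
  · omega
  · omega
  · rw [Fin.ext (by omega : i.val = j.val)]

/-- The involution that exchanges the two ends of each edge. -/
def otherEnd (σ : Equiv.Perm (Fin (m + 1))) : Equiv.Perm (Fin (m + 1) × Side) where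
  toFun
    | (i, bot) => (σ i, top)
    | (k, top) => (σ.symm k, bot)
  invFun
    | (i, bot) => (σ i, top)
    | (k, top) => (σ.symm k, bot)
  left_inv := by rintro ⟨i, _ | _⟩ <;> simp
  right_inv := by rintro ⟨i, _ | _⟩ <;> simp

@[simp]
theorem otherEnd_bot (σ : Equiv.Perm (Fin (m + 1))) (i : Fin (m + 1)) :
    otherEnd σ (i, bot) = (σ i, top) := rfl

@[simp]
theorem otherEnd_top (σ : Equiv.Perm (Fin (m + 1))) (k : Fin (m + 1)) :
    otherEnd σ (k, top) = (σ.symm k, bot) := rfl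

@[simp]
theorem otherEnd_otherEnd (σ : Equiv.Perm (Fin (m + 1))) (p : Fin (m + 1) × Side) :
    otherEnd σ (otherEnd σ p) = p := (otherEnd σ).left_inv p

/-- The cyclic successor along the bottom boundary and then the top boundary. -/
def nextPoint (p : Fin (m + 1) × Side) : Fin (m + 1) × Side :=
  if h : p.1.val + 1 < m + 1 then (⟨p.1.val + 1, h⟩, p.2)
  else (0, match p.2 with
    | bot => top
    | top => bot)

theorem position_nextPoint (p : Fin (m + 1) × Side) :
    position (nextPoint p) =
      if position p + 1 = 2 * (m + 1) then 0 else position p + 1 := by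
  obtain ⟨⟨i, hi⟩, s⟩ := p
  by_cases h : i + 1 < m + 1
  · rw [nextPoint, dif_pos h]
    cases s
    · change i + 1 = if i + 1 = 2 * (m + 1) then 0 else i + 1
      rw [if_neg (by omega)]
    · change m + 1 + (i + 1) = if m + 1 + i + 1 = 2 * (m + 1) then 0 else m + 1 + i + 1
      rw [if_neg (by omega)]
      ring
  · rw [nextPoint, dif_neg h]
    cases s
    · change m + 1 + 0 = if i + 1 = 2 * (m + 1) then 0 else i + 1
      rw [if_neg (by omega)]
      omega
    · change 0 = if m + 1 + i + 1 = 2 * (m + 1) then 0 else m + 1 + i + 1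
      rw [if_pos (by omega)]

theorem nextPoint_injective : Function.Injective (nextPoint (m := m)) := by
  intro p q h
  have h1 := congrArg position h
  rw [position_nextPoint, position_nextPoint] at h1
  apply position_injective
  split_ifs at h1 <;> omega

/-- The permutation of the black endpoints whose cycles are the strands, the rank path being
closed up. -/
noncomputable def flow (σ : Equiv.Perm (Fin (m + 1))) : Equiv.Perm (Fin (m + 1) × Side) :=
  Equiv.ofBijective (fun p => nextPoint (otherEnd σ p))
    (Finite.injective_iff_bijective.1 (nextPoint_injective.comp (otherEnd σ).injective))

theorem flow_apply (σ : Equiv.Perm (Fin (m + 1))) (p : Fin (m + 1) × Side) :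
    flow σ p = nextPoint (otherEnd σ p) := rfl

variable {σ : Equiv.Perm (Fin (m + 1))}

theorem strand_otherEnd (p : Fin (m + 1) × Side) :
    strand σ ((otherEnd σ p).1, (otherEnd σ p).2, white) = strand σ (p.1, p.2, black) := by
  obtain ⟨k, _ | _⟩ := p
  · exact (strand_edgeBlack k).symm
  · have := strand_edgeWhite (σ := σ) (σ.symm k)
    rwa [Equiv.apply_symm_apply] at this

/-- The excluded point is the end `n_w^-` of the rank path, where `nextPoint` jumps to its start
`1_b^+` without an arc. -/
theorem strand_nextPoint {p : Fin (m + 1) × Side} (hp : p ≠ (Fin.last m, bot)) :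
    strand σ (p.1, p.2, white) = strand σ ((nextPoint p).1, (nextPoint p).2, black) := by
  obtain ⟨i, s⟩ := p
  by_cases h : i.val + 1 < m + 1
  · rw [nextPoint, dif_pos h]
    exact strand_eq_of_link (Link.arc s _ _ rfl)
  · have hi : i = Fin.last m := Fin.ext (by simp; omega)
    subst hi
    rw [nextPoint, dif_neg h]
    cases s
    · exact absurd rfl hp
    · exact strand_mark

/-- Each step follows an edge and then an arc or the mark, except the one closing the rank path;
that step is forced to stay in its strand because `flow σ` is a permutation. -/
theorem strand_flow (p : Fin (m + 1) × Side) :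
    strand σ (p.1, p.2, black) = strand σ ((flow σ p).1, (flow σ p).2, black) := by
  refine rel_apply_of_rel_apply_of_ne (flow σ)
    (R := fun p q => strand σ (p.1, p.2, black) = strand σ (q.1, q.2, black))
    ⟨fun _ => rfl, fun h => h.symm, fun h h' => h.trans h'⟩ (otherEnd σ (Fin.last m, bot))
    (fun p hp => ?_) p
  rw [← strand_otherEnd, flow_apply, strand_nextPoint]
  intro h
  exact hp (by rw [← h, otherEnd_otherEnd])

/-- Mark each black endpoint with its flow cycle and each white one with that of the black end of
its edge; this is constant along links, hence on strands. -/
theorem flow_sameCycle_of_strand_eq {p q : Fin (m + 1) × Side}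
    (h : strand σ (p.1, p.2, black) = strand σ (q.1, q.2, black)) :
    (flow σ).SameCycle p q := by
  let G : Endpoint (m + 1) → Quotient (Equiv.Perm.SameCycle.setoid (flow σ)) := fun e =>
    match e with
    | (i, s, black) => Quotient.mk _ (i, s)
    | (i, s, white) => Quotient.mk _ (otherEnd σ (i, s))
  have hstep : ∀ p : Fin (m + 1) × Side, (Quotient.mk _ (otherEnd σ p) :
      Quotient (Equiv.Perm.SameCycle.setoid (flow σ))) = Quotient.mk _ (nextPoint p) := by
    intro p
    refine Quotient.sound ?_
    change (flow σ).SameCycle _ _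
    have : nextPoint p = flow σ (otherEnd σ p) := by rw [flow_apply, otherEnd_otherEnd]
    rw [this]
    exact Equiv.Perm.SameCycle.rfl.apply_right
  have hG : ∀ x y, Link σ x y → G x = G y := by
    intro x y hxy
    cases hxy with
    | edgeBlack i => simp [G]
    | edgeWhite i => simp [G]
    | arc s i j h =>
      refine (hstep (i, s)).trans ?_
      have hi : i.val + 1 < m + 1 := h ▸ j.isLt
      have : nextPoint (i, s) = (j, s) := by
        rw [nextPoint, dif_pos hi]
        exact Prod.ext (Fin.ext h) rfl
      rw [this]
    | mark i j hi hj =>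
      refine (hstep (i, top)).trans ?_
      have : nextPoint (i, top) = (j, bot) := by
        rw [nextPoint, dif_neg (by simp [hi])]
        exact Prod.ext (Fin.ext hj.symm) rfl
      rw [this]
  exact Quotient.exact (eq_of_strand_eq hG h)

end Flow

/-! ### The value of the form on a single strand -/

section StrandForm

variable {m : ℕ} {σ : Equiv.Perm (Fin (m + 1))}

open Classical in
/-- The indicator function of a strand on the endpoints. -/
noncomputable def strandIndicator (C : Strand σ) (e : Endpoint (m + 1)) : ℤ :=
  if strand σ e = C then 1 else 0

theorem strandIndicator_eq_zero_or_one (C : Strand σ) (e : Endpoint (m + 1)) :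
    strandIndicator C e = 0 ∨ strandIndicator C e = 1 := by
  unfold strandIndicator; split_ifs <;> simp

theorem strandIndicator_congr (C : Strand σ) {e e' : Endpoint (m + 1)}
    (h : strand σ e = strand σ e') : strandIndicator C e = strandIndicator C e' := by
  rw [strandIndicator, strandIndicator, h]

theorem exists_black_of_strand (C : Strand σ) :
    ∃ p : Fin (m + 1) × Side, strand σ (p.1, p.2, black) = C := by
  induction C using SimpleGraph.ConnectedComponent.ind with
  | h e =>
    obtain ⟨k, s, c⟩ := e
    cases c
    · exact ⟨(k, s), rfl⟩
    · refine ⟨otherEnd σ (k, s), ?_⟩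
      rw [← strand_otherEnd, otherEnd_otherEnd]

theorem sum_blackPoint {M : Type*} [AddCommMonoid M] (σ : Equiv.Perm (Fin (m + 1)))
    (F : Fin (m + 1) × Side → M) : ∑ p, F p = ∑ i, F (i, bot) + ∑ i, F (σ i, top) := by
  have h : ∀ f : Side → M, ∑ s, f s = f bot + f top := fun f =>
    Finset.sum_pair (by simp)
  rw [Fintype.sum_prod_type, Finset.sum_congr rfl fun i _ => h _, Finset.sum_add_distrib,
    Equiv.sum_comp σ fun k => F (k, top)]

/-- The cyclic shift preserves order except when it carries the last point to the first position. -/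
theorem position_nextPoint_lt_iff {x y : Fin (m + 1) × Side} (hxy : x ≠ y) :
    (if position (nextPoint y) < position (nextPoint x) then (1 : ZMod 2) else 0) =
      (if position y < position x then 1 else 0) +
        ((if x = (Fin.last m, top) then 1 else 0) + if y = (Fin.last m, top) then 1 else 0) := by
  have hlast : ∀ p : Fin (m + 1) × Side,
      p = (Fin.last m, top) ↔ position p + 1 = 2 * (m + 1) := by
    intro p
    rw [← position_injective.eq_iff]
    simp only [position, Fin.val_last]
    omega
  have hlt : ∀ p : Fin (m + 1) × Side, position p < 2 * (m + 1) := by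
    rintro ⟨i, _ | _⟩ <;> simp only [position] <;> omega
  have hne : position x ≠ position y := fun h => hxy (position_injective h)
  have hx := hlt x
  have hy := hlt y
  simp only [hlast, position_nextPoint]
  by_cases h1 : position x + 1 = 2 * (m + 1)
  · have h2 : ¬ position y + 1 = 2 * (m + 1) := by omega
    have h3 : position y < position x := by omega
    simp [h1, h2, h3, CharTwo.add_self_eq_zero]
  · by_cases h2 : position y + 1 = 2 * (m + 1)
    · have h3 : ¬ position y < position x := by omega
      simp [h1, h2, h3]
    · simp [h1, h2]

/-- Moving the last point of the circle to the first position flips its order with respect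
to all the other points. -/
theorem sum_inversions_flow (g : Fin (m + 1) × Side → ZMod 2) :
    (∑ a, ∑ b, if position a < position b ∧ position (flow σ b) < position (flow σ a) then
        g a * g b else 0) =
      (∑ a, ∑ b, if position a < position b ∧ position (otherEnd σ b) < position (otherEnd σ a)
        then g a * g b else 0) +
      g (σ.symm (Fin.last m), bot) * (∑ a, g a + g (σ.symm (Fin.last m), bot)) := by
  -- The point whose edge ends at `n^+`, so that its flow step passes through the mark and wraps
  -- around.
  set e : Fin (m + 1) × Side := (σ.symm (Fin.last m), bot) with he
  have hflip : ∀ p, otherEnd σ p = (Fin.last m, top) ↔ p = e := fun p => by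
    rw [← (otherEnd σ).injective.eq_iff (a := p), he]; simp
  have h1 : ∀ a b, (if position a < position b ∧
      position (flow σ b) < position (flow σ a) then g a * g b else 0) =
      (if position a < position b ∧ position (otherEnd σ b) < position (otherEnd σ a)
        then g a * g b else 0) +
      ((if a = e then (if position a < position b then g a * g b else 0) else 0) +
       (if b = e then (if position a < position b then g a * g b else 0) else 0)) := by
    intro a b
    by_cases hab : position a < position b
    · have hne : otherEnd σ a ≠ otherEnd σ b := fun h => by
        rw [(otherEnd σ).injective h] at hab; exact lt_irrefl _ hab
      have h2 := position_nextPoint_lt_iff hne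
      simp only [hflip] at h2
      have h3 := congrArg (fun z => z * (g a * g b)) h2
      simpa only [hab, true_and, if_true, flow_apply, add_mul, ite_mul, one_mul, zero_mul]
        using h3
    · simp [hab]
  have h2 : ∑ a, ∑ b, (if a = e then (if position a < position b then g a * g b else 0) else 0) =
      ∑ b, if position e < position b then g e * g b else 0 := by
    rw [Finset.sum_eq_single e]
    · simp
    · intro a _ ha; simp [ha]
    · simp
  have h3 : ∑ a, ∑ b, (if b = e then (if position a < position b then g a * g b else 0) else 0) =
      ∑ a, if position a < position e then g a * g e else 0 := by
    simp
  simp only [h1, Finset.sum_add_distrib, h2, h3]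
  congr 1
  rw [← Finset.sum_add_distrib, mul_add, Finset.mul_sum]
  have h4 : ∀ a, (if position e < position a then g e * g a else 0) +
      (if position a < position e then g a * g e else 0) =
      g e * g a + if a = e then g e * g e else 0 := by
    intro a
    by_cases ha : a = e
    · subst ha; simp [CharTwo.add_self_eq_zero]
    · have hne : position a ≠ position e := fun h => ha (position_injective h)
      rcases hne.lt_or_gt with h | h
      · simp [h, h.asymm, ha, mul_comm]
      · simp [h, h.asymm, ha]
  rw [Finset.sum_congr rfl fun a _ => h4 a, Finset.sum_add_distrib]
  simp

/-- Two bottom points, or two top points, are inverted exactly when their edges cross; a bottom and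
a top point are always inverted, which gives the product term. -/
theorem sum_inversions_otherEnd (g : Fin (m + 1) × Side → ZMod 2) :
    (∑ a, ∑ b, if position a < position b ∧ position (otherEnd σ b) < position (otherEnd σ a)
        then g a * g b else 0) =
      (∑ i, ∑ j, if i < j ∧ σ j < σ i then g (i, bot) * g (j, bot) else 0) +
      (∑ i, ∑ j, if i < j ∧ σ j < σ i then g (σ i, top) * g (σ j, top) else 0) +
      (∑ i, g (i, bot)) * ∑ i, g (σ i, top) := by
  simp only [sum_blackPoint σ]
  have hbb : ∀ i j : Fin (m + 1), (position (i, bot) < position (j, bot) ∧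
      position (otherEnd σ (j, bot)) < position (otherEnd σ (i, bot))) ↔ i < j ∧ σ j < σ i := by
    intro i j; simp [position]
  have hbt : ∀ i j : Fin (m + 1), position (i, bot) < position (σ j, top) ∧
      position (otherEnd σ (σ j, top)) < position (otherEnd σ (i, bot)) := by
    intro i j
    simp only [otherEnd_bot, otherEnd_top, position, Equiv.symm_apply_apply]
    omega
  have htb : ∀ i j : Fin (m + 1), ¬ (position (σ i, top) < position (j, bot) ∧
      position (otherEnd σ (j, bot)) < position (otherEnd σ (σ i, top))) := by
    intro i j
    simp only [position]
    omega
  have htt : ∀ i j : Fin (m + 1), (position (σ i, top) < position (σ j, top) ∧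
      position (otherEnd σ (σ j, top)) < position (otherEnd σ (σ i, top))) ↔
      j < i ∧ σ i < σ j := by
    intro i j; simp [position, and_comm]
  simp only [hbb, hbt, htb, htt, and_self, if_true, if_false, Finset.sum_const_zero, zero_add,
    Finset.sum_add_distrib, Finset.sum_mul_sum]
  have hswap : (∑ i, ∑ j, if j < i ∧ σ i < σ j then g (σ i, top) * g (σ j, top) else 0) =
      ∑ i, ∑ j, if i < j ∧ σ j < σ i then g (σ i, top) * g (σ j, top) else 0 := by
    rw [Finset.sum_comm]
    exact Finset.sum_congr rfl fun i _ => Finset.sum_congr rfl fun j _ => by rw [mul_comm]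
  rw [hswap]
  ring

/-- Stated over `ℤ` since the parity of the pair count requires a division by 2. -/
theorem sum_sq_eq_two_mul_sum_lt_add {n : ℕ} (f : Fin n → ℤ) :
    (∑ i, f i) ^ 2 = 2 * (∑ i, ∑ j, if i < j then f i * f j else 0) + ∑ i, f i ^ 2 := by
  have h : ∀ i j : Fin n, f i * f j = (if i < j then f i * f j else 0) +
      (if j < i then f j * f i else 0) + if i = j then f i ^ 2 else 0 := by
    intro i j
    rcases lt_trichotomy i j with h | h | h
    · simp [h, h.asymm, h.ne]
    · subst h; simp [sq]
    · simp [h, h.asymm, h.ne', mul_comm]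
  rw [sq, Finset.sum_mul_sum, Finset.sum_congr rfl fun i _ => Finset.sum_congr rfl fun j _ => h i j]
  simp only [Finset.sum_add_distrib]
  have hswap : (∑ i, ∑ j, if j < i then f j * f i else 0) =
      ∑ i, ∑ j, if i < j then f i * f j else 0 := Finset.sum_comm
  rw [hswap]
  simp
  ring

theorem quadForm_noncross_add {n : ℕ} (σ : Equiv.Perm (Fin n)) (x : Fin n → ZMod 2) :
    quadForm (noncross σ) x = ∑ i, x i + (∑ i, ∑ j, if i < j then x i * x j else 0) +
      ∑ i, ∑ j, if i < j ∧ σ j < σ i then x i * x j else 0 := by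
  rw [quadForm, add_assoc]
  congr 1
  rw [← Finset.sum_add_distrib]
  refine Finset.sum_congr rfl fun i _ => ?_
  rw [← Finset.sum_add_distrib]
  refine Finset.sum_congr rfl fun j _ => ?_
  unfold noncross
  by_cases h : i < j
  · rcases lt_trichotomy (σ i) (σ j) with hs | hs | hs
    · simp [h, hs, hs.asymm]
    · exact absurd (σ.injective hs) h.ne
    · simp [h, hs, hs.asymm, CharTwo.add_self_eq_zero]
  · simp [h]

/-- Black bottom endpoints correspond by edges to white top ones, each of which starts a top arc,
except the last, which lies on the mark. -/
theorem sum_strandIndicator_black (C : Strand σ) :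
    ∑ i, strandIndicator C (i, bot, black) =
      length σ C + strandIndicator C (0, bot, black) := by
  have h1 : ∑ i, strandIndicator C (i, bot, black) = ∑ k, strandIndicator C (k, top, white) :=
    (Finset.sum_congr rfl fun i _ => strandIndicator_congr C (strand_edgeBlack i)).trans
      (Equiv.sum_comp σ fun k => strandIndicator C (k, top, white))
  rw [h1, Fin.sum_univ_castSucc, strandIndicator_congr C strand_mark, length, Finset.card_filter]
  rw [Fin.sum_univ_castSucc, if_neg (by simp), add_zero]
  push_cast
  congr 1
  refine Finset.sum_congr rfl fun i _ => ?_
  have hlt : (i.castSucc : ℕ) + 1 < m + 1 := by simp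
  unfold strandIndicator
  split_ifs with h2 h3 h3
  · rfl
  · exact absurd ⟨hlt, h2⟩ h3
  · exact absurd h3.2 h2
  · rfl

theorem sum_strandIndicator_white (C : Strand σ) :
    ∑ i, strandIndicator C (i, bot, white) =
      length σ C + strandIndicator C (Fin.last m, bot, white) := by
  have h1 := sum_strandIndicator_black C
  rw [Fin.sum_univ_succ] at h1
  rw [Fin.sum_univ_castSucc, Finset.sum_congr rfl fun i _ =>
    strandIndicator_congr C (strand_arc bot i)]
  linarith

/-- The inversions of the flow along a single strand. -/
theorem sum_inversions_strand (C : Strand σ) (u w : Fin (m + 1) → ZMod 2)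
    (hu : ∀ i, u i = strandIndicator C (i, bot, black))
    (hw : ∀ i, w i = strandIndicator C (i, bot, white)) :
    (∑ i, ∑ j, if i < j ∧ σ j < σ i then u i * u j else 0) +
      (∑ i, ∑ j, if i < j ∧ σ j < σ i then w i * w j else 0) + (∑ i, u i) * (∑ i, w i) +
      u 0 * (∑ i, u i + ∑ i, w i + u 0) = ∑ i, u i + ∑ i, w i + 1 := by
  classical
  let p : Fin (m + 1) × Side → Prop := fun a => strand σ (a.1, a.2, black) = C
  let g : Fin (m + 1) × Side → ZMod 2 := fun a => if p a then 1 else 0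
  have hgu : ∀ i, g (i, bot) = u i := fun i => by
    simp only [g, p, hu, strandIndicator]; push_cast; rfl
  have hgw : ∀ i, g (σ i, top) = w i := fun i => by
    simp only [g, p, hw, strandIndicator, strand_edgeWhite]; push_cast; rfl
  -- The edge into `n_w^+` continues through the mark to `1_b^-`.
  have hge : g (σ.symm (Fin.last m), bot) = u 0 := by
    rw [hgu, hu, hu]
    have := strand_edgeBlack (σ := σ) (σ.symm (Fin.last m))
    rw [Equiv.apply_symm_apply, strand_mark] at this
    rw [strandIndicator_congr C this]
  have h1 := sum_inversions_of_cycle position position_injective (flow σ) p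
    (fun x => by simp only [p, ← strand_flow]) (exists_black_of_strand C)
    (fun x y hx hy => flow_sameCycle_of_strand_eq (Eq.trans hx (Eq.symm hy)))
  have h2 := sum_inversions_flow (σ := σ) g
  have h3 := sum_inversions_otherEnd (σ := σ) g
  have h4 : ∑ a, g a = ∑ i, u i + ∑ i, w i := by
    rw [sum_blackPoint σ]; simp only [hgu, hgw]
  change _ = ∑ a, g a + 1 at h1
  rw [← h4, ← h1]
  refine Eq.trans ?_ h2.symm
  rw [h3, hge]
  simp only [hgu, hgw]

/-- The vector of `C` is `u + w`, the indicators of its black and white halves. As it lies in the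
radical, its value is `q(u) + q(w)`. Mod 2, non-crossing pairs are all pairs plus crossing pairs:
the former depend only on the numbers of halves, the latter are given by `sum_inversions_strand`. -/
theorem strandForm_single [DecidableEq (Strand σ)] (C : Strand σ) :
    strandForm σ (Pi.single C 1) = length σ C + 1 := by
  let u : Fin (m + 1) → ZMod 2 := fun i => strandIndicator C (i, bot, black)
  let w : Fin (m + 1) → ZMod 2 := fun i => strandIndicator C (i, bot, white)
  have hsingle : ∀ e : Endpoint (m + 1),
      (Pi.single C (1 : ZMod 2) : Strand σ → ZMod 2) (strand σ e) = strandIndicator C e := by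
    intro e
    by_cases h : strand σ e = C <;> simp [strandIndicator, h]
  set x := labelVec σ (Pi.single C 1) with hx
  have hxw : u + x = w := by
    funext i
    change u i + ((Pi.single C 1 : Strand σ → ZMod 2) (strand σ (i, bot, white)) +
      (Pi.single C 1 : Strand σ → ZMod 2) (strand σ (i, bot, black))) = w i
    rw [hsingle, hsingle]
    linear_combination CharTwo.add_self_eq_zero (u i)
  have hq : quadForm (noncross σ) x =
      quadForm (noncross σ) u + quadForm (noncross σ) w := by
    rw [← hxw, quadForm_add_of_polarVec_eq_zero _ u (polarVec_labelVec _)]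
    linear_combination - CharTwo.add_self_eq_zero (quadForm (noncross σ) u)
  change quadForm (noncross σ) x = _
  rw [hq, quadForm_noncross_add, quadForm_noncross_add]
  have hinv := sum_inversions_strand C u w (fun _ => rfl) fun _ => rfl
  have hsq : ∀ e : Endpoint (m + 1), strandIndicator C e ^ 2 = strandIndicator C e := fun e => by
    rcases strandIndicator_eq_zero_or_one C e with h | h <;> rw [h] <;> norm_num
  have hU := sum_sq_eq_two_mul_sum_lt_add fun i => strandIndicator C (i, bot, black)
  have hW := sum_sq_eq_two_mul_sum_lt_add fun i => strandIndicator C (i, bot, white)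
  simp only [hsq] at hU hW
  have ha := sum_strandIndicator_black C
  have hb := sum_strandIndicator_white C
  have hcu : ∑ i, u i = ((∑ i, strandIndicator C (i, bot, black) : ℤ) : ZMod 2) := by
    push_cast; rfl
  have hcw : ∑ i, w i = ((∑ i, strandIndicator C (i, bot, white) : ℤ) : ZMod 2) := by
    push_cast; rfl
  have htu : (∑ i, ∑ j, if i < j then u i * u j else 0) = ((∑ i, ∑ j, if i < j then
      strandIndicator C (i, bot, black) * strandIndicator C (j, bot, black) else 0 : ℤ) :
        ZMod 2) := by
    push_cast; rfl
  have htw : (∑ i, ∑ j, if i < j then w i * w j else 0) = ((∑ i, ∑ j, if i < j then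
      strandIndicator C (i, bot, white) * strandIndicator C (j, bot, white) else 0 : ℤ) :
        ZMod 2) := by
    push_cast; rfl
  rw [htu, htw]
  rw [hcu, hcw] at hinv ⊢
  have hu0 : u 0 = strandIndicator C (0, bot, black) := rfl
  rw [hu0] at hinv
  generalize (∑ i, ∑ j, if i < j ∧ σ j < σ i then u i * u j else 0) = X at *
  generalize (∑ i, ∑ j, if i < j ∧ σ j < σ i then w i * w j else 0) = Y at *
  generalize (∑ i, ∑ j, if i < j then
      strandIndicator C (i, bot, black) * strandIndicator C (j, bot, black) else 0) = s at *
  generalize (∑ i, ∑ j, if i < j then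
      strandIndicator C (i, bot, white) * strandIndicator C (j, bot, white) else 0) = t at *
  generalize (∑ i, strandIndicator C (i, bot, black)) = a at *
  generalize (∑ i, strandIndicator C (i, bot, white)) = b at *
  have hμ := strandIndicator_eq_zero_or_one C (0, bot, black)
  have hρ := strandIndicator_eq_zero_or_one C (Fin.last m, bot, white)
  generalize strandIndicator C (0, bot, black) = μ at *
  generalize strandIndicator C (Fin.last m, bot, white) = ρ at *
  generalize length σ C = L at *
  -- Here `a = L + μ`, `b = L + ρ`, and `hU`, `hW` give `2s = a² - a`, `2t = b² - b`. The witnesses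
  -- are half of the resulting polynomial in `L`.
  have hkey : ∃ k : ℤ, a + b + s + t + a * b + (a + b + 1) + μ * (a + b + μ) - (L + 1) = 2 * k := by
    subst ha hb
    rcases hμ with rfl | rfl <;> rcases hρ with rfl | rfl
    · exact ⟨L ^ 2 + L, by linarith⟩
    · exact ⟨L ^ 2 + 2 * L + 1, by linarith⟩
    · exact ⟨L ^ 2 + 3 * L + 2, by linarith⟩
    · exact ⟨L ^ 2 + 4 * L + 4, by linarith⟩
  obtain ⟨k, hk⟩ := hkey
  have hk' := congrArg (Int.cast : ℤ → ZMod 2) hk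
  push_cast at hk'
  have h2 : (2 : ZMod 2) = 0 := rfl
  rw [h2, zero_mul] at hk'
  linear_combination hk' + hinv +
    (1 + a + b - (a * b + (a + b + 1) + μ * (a + b + μ))) * h2

end StrandForm

/-! ### Parity of the even parts and value of the Arf invariant -/

theorem cycleStructure_add_rank {n : ℕ} [NeZero n] (σ : Equiv.Perm (Fin n)) [Fintype (Strand σ)] :
    cycleStructure σ + {rank σ} = (Finset.univ : Finset (Strand σ)).val.map (length σ) := by
  classical
  have h : (Finset.univ : Finset (Strand σ)).val = rankPath σ ::ₘ (cycles σ).val := by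
    have h1 : insert (rankPath σ) (cycles σ) = (Finset.univ : Finset (Strand σ)) := by
      ext C
      by_cases hC : C = rankPath σ <;> simp [cycles, hC]
    rw [← h1, Finset.insert_val_of_notMem (by simp [cycles])]
  rw [h, Multiset.map_cons, cycleStructure, rank, add_comm, Multiset.singleton_add]

theorem card_strand {n : ℕ} [NeZero n] (σ : Equiv.Perm (Fin n)) [Fintype (Strand σ)] :
    Fintype.card (Strand σ) = numCycles σ + 1 := by
  have h := congrArg Multiset.card (cycleStructure_add_rank σ)
  simp only [cycleStructure, Multiset.card_add, Multiset.card_map, Multiset.card_singleton,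
    Finset.card_val, Finset.card_univ] at h
  exact h.symm

section Arf

variable {m : ℕ} (σ : Equiv.Perm (Fin (m + 1)))

/-- Mod 2, `length + 1` is the indicator of an even length, and these values sum to that of the
all-ones labelling, which is zero. -/
theorem even_countP_even :
    Even ((cycleStructure σ + {rank σ}).countP Even) := by
  classical
  have : Fintype (Strand σ) := Fintype.ofFinite _
  rw [cycleStructure_add_rank, Multiset.countP_map, ← Finset.filter_val, Finset.card_val,
    Finset.card_filter, ← ZMod.natCast_eq_zero_iff_even, ← strandForm_one (σ := σ), Nat.cast_sum]
  refine Finset.sum_congr rfl fun C _ => ?_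
  rw [strandForm_single]
  by_cases h : Even (length σ C)
  · rw [if_pos h, (ZMod.natCast_eq_zero_iff_even).2 h]; simp
  · rw [if_neg h, (ZMod.natCast_eq_one_iff_odd).2 (Nat.not_even_iff_odd.1 h)]; rfl

theorem arf_sq_of_forall_odd (h : ∀ k ∈ cycleStructure σ + {rank σ}, ¬ Even k) :
    arf σ ^ 2 = 2 ^ (m + 1 + numCycles σ) := by
  classical
  have : Fintype (Strand σ) := Fintype.ofFinite _
  rw [cycleStructure_add_rank] at h
  have h0 : strandForm σ = 0 := by
    refine AddMonoidHom.functions_ext _ _ _ fun C x => ?_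
    have h1 : strandForm σ (Pi.single C 1) = 0 := by
      have hC : ¬ Even (length σ C) := h _ (Multiset.mem_map_of_mem _ (Finset.mem_univ C))
      rw [strandForm_single, (ZMod.natCast_eq_one_iff_odd).2 (Nat.not_even_iff_odd.1 hC)]
      rfl
    by_cases hx : x = 0
    · simp [hx]
    · rw [zmod_two_eq_one_of_ne_zero hx, h1]; rfl
  have h1 := two_mul_arf_sq (σ := σ)
  rw [sum_signChar_of_eq_zero _ fun x => by rw [h0]; rfl] at h1
  rw [Fintype.card_fun, ZMod.card, card_strand] at h1
  push_cast at h1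
  rw [pow_succ 2 (numCycles σ)] at h1
  rw [pow_add]
  linarith

theorem arf_eq_zero_of_exists_even (h : ∃ k ∈ cycleStructure σ + {rank σ}, Even k) :
    arf σ = 0 := by
  classical
  have : Fintype (Strand σ) := Fintype.ofFinite _
  rw [cycleStructure_add_rank] at h
  obtain ⟨k, hk, hev⟩ := h
  obtain ⟨C, _, rfl⟩ := Multiset.mem_map.1 hk
  have h0 : strandForm σ (Pi.single C 1) ≠ 0 := by
    rw [strandForm_single, (ZMod.natCast_eq_zero_iff_even).2 hev]; simp
  have h1 := two_mul_arf_sq (σ := σ)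
  rw [sum_signChar_of_ne_zero _ h0] at h1
  simpa using h1

theorem arf_eq_or_eq_neg (h : ∀ k ∈ cycleStructure σ + {rank σ}, ¬ Even k) :
    (arf σ : ℝ) = (2 : ℝ) ^ (((m + 1 : ℕ) + (numCycles σ : ℝ)) / 2) ∨
      (arf σ : ℝ) = -(2 : ℝ) ^ (((m + 1 : ℕ) + (numCycles σ : ℝ)) / 2) := by
  -- Squaring turns the possibly half-integral exponent into a natural number.
  rw [← sq_eq_sq_iff_eq_or_eq_neg, ← Real.rpow_mul_natCast zero_le_two, Nat.cast_two,
    div_mul_cancel₀ _ two_ne_zero, ← Nat.cast_add, Real.rpow_natCast]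
  exact_mod_cast arf_sq_of_forall_odd σ h

end Arf

end Rauzy

theorem theorem2 (n : ℕ) [NeZero n] (σ : Equiv.Perm (Fin n)) :
    Even ((Rauzy.cycleStructure σ + {Rauzy.rank σ}).countP Even) ∧
    ((∀ k ∈ Rauzy.cycleStructure σ + {Rauzy.rank σ}, ¬ Even k) →
      ((Rauzy.arf σ : ℝ) = (2 : ℝ) ^ (((n : ℝ) + (Rauzy.numCycles σ : ℝ)) / 2) ∨
       (Rauzy.arf σ : ℝ) = -(2 : ℝ) ^ (((n : ℝ) + (Rauzy.numCycles σ : ℝ)) / 2))) ∧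
    ((∃ k ∈ Rauzy.cycleStructure σ + {Rauzy.rank σ}, Even k) → Rauzy.arf σ = 0) ∧
    (Rauzy.sgn σ : ℝ) =
      (2 : ℝ) ^ (-(((n : ℝ) + (Rauzy.numCycles σ : ℝ)) / 2)) * (Rauzy.arf σ : ℝ) := by
  obtain ⟨m, rfl⟩ := Nat.exists_eq_succ_of_ne_zero (NeZero.ne n)
  refine ⟨Rauzy.even_countP_even σ, Rauzy.arf_eq_or_eq_neg σ,
    Rauzy.arf_eq_zero_of_exists_even σ, ?_⟩
  by_cases h : ∃ k ∈ Rauzy.cycleStructure σ + {Rauzy.rank σ}, Even k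
  · rw [Rauzy.sgn, Rauzy.arf_eq_zero_of_exists_even σ h]
    simp
  · push Not at h
    have hpos : (0 : ℝ) < 2 ^ (((m + 1 : ℕ) + (Rauzy.numCycles σ : ℝ)) / 2) :=
      Real.rpow_pos_of_pos zero_lt_two _
    rw [Rauzy.sgn, Real.rpow_neg zero_le_two]
    rcases Rauzy.arf_eq_or_eq_neg σ fun k hk => by simpa using h k hk with h1 | h1
    · have h2 : 0 < Rauzy.arf σ := by
        rw [← Int.cast_pos (R := ℝ), h1]; exact hpos
      rw [Int.sign_eq_one_of_pos h2, h1, inv_mul_cancel₀ hpos.ne', Int.cast_one]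
    · have h2 : Rauzy.arf σ < 0 := by
        rw [← Int.cast_lt_zero (R := ℝ), h1]; exact neg_lt_zero.2 hpos
      rw [Int.sign_eq_neg_one_of_neg h2, h1, mul_neg, inv_mul_cancel₀ hpos.ne']
      simp
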